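/- Let $[n]=\{1,\dots,n\}$. Let $D$ be a digraph (loops allowed) with vertex set $[n]$ and let $s=(s_1,\dots,s_m)\in[n]^m$. Drivers $1,\dots,m$ enter $D$ one after another. Driver $i$ starts at $s_i$; whenever her current vertex is unoccupied she parks there, and whenever it is occupied she chooses an out-neighbour of it and drives there. The sequence $s$ is a \emph{parking function on $D$} if the drivers can make their choices so that all $m$ of them park, and $P(D,m)$ denotes the number of parking functions $s\in[n]^m$ on $D$. A \emph{source tree} on $[n]$ is a digraph obtained from a rooted tree with vertex set $[n]$ by orienting every edge away from the root; $\widetilde{\mathcal T}_n$ is the set of all of them. The \emph{inverse mapping digraph} of $f:[n]\to[n]$ is the digraph $\widetilde M_f$ with vertex set $[n]$ and edge set $\{(f(i),i): i\in[n]\}$; $\widetilde{\mathcal M}_n$ is the set of all of them. Put \[ \widetilde F_{n,m}=\sum_{D\in\widetilde{\mathcal T}_n}P(D,m),\qquad \widetilde M_{n,m}=\sum_{D\in\widetilde{\mathcal M}_n}P(D,m). \] Theorem. For every $n\ge 1$, \[ n\cdot\widetilde F_{n,n}=\widetilde M_{n,n}. \] -/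

import Mathlib

namespace DigraphParking

/-- `Drives D O u v`: in the digraph `D`, when `O` is the set of occupied vertices, a driver who is
currently at `u` can end up parking at `v`: if `u` is unoccupied she parks there, and if `u` is
occupied she drives along some edge leaving `u` and continues from its head. -/
inductive Drives {V : Type*} (D : Digraph V) (O : Set V) : V → V → Prop
  | park {v : V} (hv : v ∉ O) : Drives D O v v
  | drive {u w v : V} (hu : u ∈ O) (huw : D.Adj u w) (hw : Drives D O w v) : Drives D O u v

/-- `s` is a parking function on `D`: the drivers can make their choices so that all of them park.
Here `p i` is the vertex in which driver `i` parks; the vertices occupied when she enters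
are the `p j` with `j < i`. -/
def IsParkingFunction {V : Type*} {m : ℕ} (D : Digraph V) (s : Fin m → V) : Prop :=
  ∃ p : Fin m → V, ∀ i : Fin m, Drives D {v | ∃ j : Fin m, j < i ∧ p j = v} (s i) (p i)

/-- The number of parking functions with `m` drivers on `D`. -/
noncomputable def numParking {V : Type*} (D : Digraph V) (m : ℕ) : ℕ :=
  Set.ncard {s : Fin m → V | IsParkingFunction D s}

/-- The digraph with all edge orientations reversed. -/
def reverse {V : Type*} (D : Digraph V) : Digraph V where
  Adj u v := D.Adj v u

/-- The graph `G` with each edge oriented towards the vertex `r`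
(meant for a tree `G` with root `r`). -/
def orientTowards {V : Type*} (G : SimpleGraph V) (r : V) : Digraph V where
  Adj u v := G.Adj u v ∧ G.dist r u = G.dist r v + 1

/-- The rooted sink trees with vertex set `Fin n`: rooted trees with all edges oriented
towards the root. -/
def sinkTrees (n : ℕ) : Set (Digraph (Fin n)) :=
  {D | ∃ (G : SimpleGraph (Fin n)) (r : Fin n), G.IsTree ∧ D = orientTowards G r}

/-- The rooted source trees with vertex set `Fin n`: the reversals of the sink trees. -/
def sourceTrees (n : ℕ) : Set (Digraph (Fin n)) :=
  reverse '' sinkTrees n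

/-- The mapping digraph of `f`, with an edge from `i` to `f i` for each `i`. -/
def mappingDigraph {V : Type*} (f : V → V) : Digraph V where
  Adj u v := f u = v

/-- The mapping digraphs with vertex set `Fin n`. -/
def mappingDigraphs (n : ℕ) : Set (Digraph (Fin n)) :=
  Set.range mappingDigraph

/-- The inverse mapping digraphs with vertex set `Fin n`: the reversals of the mapping digraphs. -/
def inverseMappingDigraphs (n : ℕ) : Set (Digraph (Fin n)) :=
  reverse '' mappingDigraphs n

/-- The total number of parking functions with `m` drivers on source trees with `n` vertices. -/
noncomputable def sourceTreeTotal (n m : ℕ) : ℕ :=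
  ∑ D ∈ (Set.toFinite (sourceTrees n)).toFinset, numParking D m

/-- The total number of parking functions with `m` drivers on inverse mapping digraphs with
`n` vertices. -/
noncomputable def inverseMappingTotal (n m : ℕ) : ℕ :=
  ∑ D ∈ (Set.toFinite (inverseMappingDigraphs n)).toFinset, numParking D m

end DigraphParking

/-!
By an exchange argument, `s` is a parking function on `D` if and only if the drivers can be assigned
distinct parking spaces which they can reach in `D`. If `D` is the digraph of the edges `(f v, v)`
for a map `f`, then Hall's theorem turns this into the condition that, for every vertex `v`, the
excess of drivers over parking spaces sums to at most `0` over the vertices which some iterate of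
`f` sends to `v`. So it suffices to count, for a fixed `s`, the parent maps of rooted trees and all
maps subject to this condition; it depends on `s` only through the weights given by the excess.

As in Joyal's proof of Cayley's formula, a rooted tree with a marked vertex is a path (from the
marked vertex to the root) with a forest attached to it, and a map is a permutation (of its periodic
points) with a forest attached to it. With the forest and the set of its roots fixed, give each root
the total weight of its tree. The condition then says that all prefix sums along the path are
nonpositive, or that all cycles of the permutation have nonpositive sums. That there are equally
many of both is a form of Spitzer's combinatorial lemma: an element of nonpositive weight can be
merged into its successor in the path or in its cycle, and inserting it back before any given
element, or at the end of the path respectively as a cycle of its own, gives the same recursion for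
both counts.
-/

namespace DigraphParking

open Function Relation

section Parking

variable {V : Type*} {D : Digraph V} {O : Set V}

lemma Drives.notMem {u v : V} (h : Drives D O u v) : v ∉ O := by
  induction h with
  | park hv => exact hv
  | drive _ _ _ ih => exact ih

lemma Drives.reflTransGen {u v : V} (h : Drives D O u v) : ReflTransGen D.Adj u v := by
  induction h with
  | park _ => exact .refl
  | drive _ huw _ ih => exact .head huw ih

lemma exists_drives_of_reflTransGen {u v : V} (h : ReflTransGen D.Adj u v) (hv : v ∉ O) :
    ∃ w, Drives D O u w ∧ ReflTransGen D.Adj w v := by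
  induction h using ReflTransGen.head_induction_on with
  | refl => exact ⟨v, .park hv, .refl⟩
  | @head a c hac hcv ih =>
    by_cases ha : a ∈ O
    · obtain ⟨w, hcw, hwv⟩ := ih
      exact ⟨w, .drive ha hac hcw, hwv⟩
    · exact ⟨a, .park ha, .head hac hcv⟩

/- Driver `i` sets out for `p i` and parks at the first free vertex `w` on her way; whoever was
assigned `w` takes over `p i`, which is still reachable through `w`. -/
lemma exists_reassignment {ι : Type*} {s p : ι → V} (hp : Injective p)
    (hreach : ∀ j, ReflTransGen D.Adj (s j) (p j)) {i : ι} (hi : p i ∉ O) :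
    ∃ p' : ι → V, Injective p' ∧ (∀ j, ReflTransGen D.Adj (s j) (p' j)) ∧
      (∀ j, p j ∈ O → p' j = p j) ∧ Drives D O (s i) (p' i) := by
  classical
  obtain ⟨w, hiw, hwi⟩ := exists_drives_of_reflTransGen (hreach i) hi
  refine ⟨Equiv.swap (p i) w ∘ p, (Equiv.injective _).comp hp, fun j => ?_, fun j hj => ?_, ?_⟩
  · rcases eq_or_ne (p j) (p i) with hji | hji
    · simpa [hp hji] using hiw.reflTransGen
    rcases eq_or_ne (p j) w with hjw | hjw
    · simpa [hjw] using (hjw ▸ hreach j).trans hwi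
    · simpa [Equiv.swap_apply_of_ne_of_ne hji hjw] using hreach j
  · exact Equiv.swap_apply_of_ne_of_ne (ne_of_mem_of_not_mem hj hi)
      (ne_of_mem_of_not_mem hj hiw.notMem)
  · simpa using hiw

lemma exists_injective_drives {m : ℕ} {s p : Fin m → V} (hp : Injective p)
    (hreach : ∀ i, ReflTransGen D.Adj (s i) (p i)) {k : ℕ} (hk : k ≤ m) :
    ∃ q : Fin m → V, Injective q ∧ (∀ i, ReflTransGen D.Adj (s i) (q i)) ∧
      ∀ i : Fin m, (i : ℕ) < k → Drives D {v | ∃ j < i, q j = v} (s i) (q i) := by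
  induction k with
  | zero => exact ⟨p, hp, hreach, by simp⟩
  | succ k ih =>
    obtain ⟨q, hq, hqreach, hdrives⟩ := ih (by omega)
    let c : Fin m := ⟨k, hk⟩
    have hfree : q c ∉ {v | ∃ j < c, q j = v} := fun ⟨j, hj, hjc⟩ => hj.ne (hq hjc)
    obtain ⟨q', hq', hreach', hkeep, hc⟩ := exists_reassignment hq hqreach hfree
    have hoccupied : ∀ i ≤ c, {v | ∃ j < i, q' j = v} = {v | ∃ j < i, q j = v} := by
      intro i hi
      ext v
      refine exists_congr fun j => and_congr_right fun hj => ?_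
      rw [hkeep j ⟨j, hj.trans_le hi, rfl⟩]
    refine ⟨q', hq', hreach', fun i hi => ?_⟩
    rcases (show i ≤ c from Nat.le_of_lt_succ hi).lt_or_eq with hlt | rfl
    · rw [hoccupied i hlt.le, hkeep i ⟨i, hlt, rfl⟩]
      exact hdrives i hlt
    · rwa [hoccupied _ le_rfl]

lemma isParkingFunction_iff_exists_injective {m : ℕ} {s : Fin m → V} :
    IsParkingFunction D s ↔
      ∃ p : Fin m → V, Injective p ∧ ∀ i, ReflTransGen D.Adj (s i) (p i) := by
  constructor
  · rintro ⟨p, hp⟩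
    have hne : ∀ i j, i < j → p i ≠ p j := fun i j hij heq => (hp j).notMem ⟨i, hij, heq⟩
    exact ⟨p, .of_lt_imp_ne hne, fun i => (hp i).reflTransGen⟩
  · rintro ⟨p, hp, hreach⟩
    obtain ⟨q, -, -, hq⟩ := exists_injective_drives hp hreach le_rfl
    exact ⟨q, fun i => hq i i.2⟩

end Parking

section Descendants

variable {V : Type*} [Fintype V]

open Classical in
/-- The descendants of `v` under a parent map `f`: the vertices from which iterating `f` leads
to `v`, including `v` itself. -/
noncomputable def descendants (f : V → V) (v : V) : Finset V := {u | ∃ k, f^[k] u = v}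

@[simp] lemma mem_descendants {f : V → V} {u v : V} :
    u ∈ descendants f v ↔ ∃ k, f^[k] u = v := by
  simp [descendants]

lemma self_mem_descendants (f : V → V) (v : V) : v ∈ descendants f v :=
  mem_descendants.2 ⟨0, rfl⟩

lemma mem_descendants_of_apply_mem {f : V → V} {u v : V} (h : f u ∈ descendants f v) :
    u ∈ descendants f v := by
  obtain ⟨k, hk⟩ := mem_descendants.1 h
  exact mem_descendants.2 ⟨k + 1, hk⟩

lemma descendants_subset {f : V → V} {U : Finset V} (hU : ∀ u, f u ∈ U → u ∈ U) {v : V}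
    (hv : v ∈ U) : descendants f v ⊆ U := by
  intro u hu
  obtain ⟨k, rfl⟩ := mem_descendants.1 hu
  induction k generalizing u with
  | zero => exact hv
  | succ k ih => exact hU u (ih hv (mem_descendants.2 ⟨k, rfl⟩))

lemma exists_sdiff_descendants_closed {f : V → V} {U : Finset V} (hne : U.Nonempty) :
    ∃ v ∈ U, ∀ u, f u ∈ U → f u ∉ descendants f v → u ∉ descendants f v := by
  obtain ⟨v, hv, hmax⟩ := U.exists_max_image (fun v => (descendants f v).card) hne
  refine ⟨v, hv, fun u hfu hfuv huv => hfuv ?_⟩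
  obtain ⟨k, hk⟩ := mem_descendants.1 huv
  cases k with
  | succ k => exact mem_descendants.2 ⟨k, hk⟩
  | zero =>
    obtain rfl : u = v := hk
    have hsub : descendants f u ⊆ descendants f (f u) :=
      descendants_subset (fun _ => mem_descendants_of_apply_mem)
        (mem_descendants_of_apply_mem (self_mem_descendants f (f u)))
    rw [Finset.eq_of_subset_of_card_le hsub (hmax _ hfu)]
    exact self_mem_descendants f (f u)

variable {M : Type*} [AddCommMonoid M] [Preorder M]

/-- The condition that the weights of the descendants of each vertex have a nonpositive sum; for
`w = excess s` it is Hall's criterion for `s` to be a parking function. -/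
def DescendantSumsNonpos (f : V → V) (w : V → M) : Prop :=
  ∀ v, ∑ u ∈ descendants f v, w u ≤ 0

lemma DescendantSumsNonpos.sum_nonpos [AddLeftMono M] {f : V → V} {w : V → M}
    (h : DescendantSumsNonpos f w) {U : Finset V} (hU : ∀ u, f u ∈ U → u ∈ U) :
    ∑ u ∈ U, w u ≤ 0 := by
  classical
  induction U using Finset.strongInduction with
  | H U ih =>
    rcases U.eq_empty_or_nonempty with rfl | hne
    · simp
    obtain ⟨v, hv, hclosed⟩ := exists_sdiff_descendants_closed hne
    rw [← Finset.sum_sdiff (descendants_subset hU hv)]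
    refine add_nonpos (ih _ ?_ fun u hu => ?_) (h v)
    · exact Finset.sdiff_ssubset (descendants_subset hU hv) ⟨v, self_mem_descendants f v⟩
    · rw [Finset.mem_sdiff] at hu ⊢
      exact ⟨hU u hu.1, hclosed u hu.1 hu.2⟩

end Descendants

section Hall

variable {V : Type*}

open Classical in
/-- The number of drivers of `s` starting at `v`, minus the one parking space there. -/
noncomputable def excess {m : ℕ} (s : Fin m → V) (v : V) : ℤ :=
  Finset.card {i | s i = v} - 1

open Classical in
lemma sum_excess {m : ℕ} (s : Fin m → V) (U : Finset V) :
    ∑ v ∈ U, excess s v = Finset.card {i | s i ∈ U} - U.card := by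
  have hfiber : ∀ v ∈ U, Finset.card {i ∈ Finset.univ.filter (s · ∈ U) | s i = v} =
      Finset.card {i | s i = v} := by
    intro v hv
    congr 1
    ext i
    simp only [Finset.mem_filter, Finset.mem_univ, true_and]
    exact ⟨And.right, fun h => ⟨h ▸ hv, h⟩⟩
  rw [Finset.card_eq_sum_card_fiberwise (f := s) (t := U) (by intro i; simp),
    Finset.sum_congr rfl hfiber]
  simp [excess]

lemma isParkingFunction_iff_descendantSumsNonpos [Fintype V] {D : Digraph V} {f : V → V}
    (hD : ∀ u v, ReflTransGen D.Adj u v ↔ ∃ k, f^[k] v = u) {m : ℕ} {s : Fin m → V} :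
    IsParkingFunction D s ↔ DescendantSumsNonpos f (excess s) := by
  classical
  simp only [isParkingFunction_iff_exists_injective, hD, ← mem_descendants]
  rw [← Finset.all_card_le_biUnion_card_iff_exists_injective fun i => descendants f (s i)]
  constructor
  · intro h v
    rw [sum_excess, sub_nonpos, Nat.cast_le]
    refine (h _).trans (Finset.card_le_card (Finset.biUnion_subset.2 fun i hi => ?_))
    exact descendants_subset (fun _ => mem_descendants_of_apply_mem) (Finset.mem_filter.1 hi).2
  · intro h A
    have hsum := h.sum_nonpos (U := A.biUnion fun i => descendants f (s i)) fun u hu => by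
      obtain ⟨i, hi, hui⟩ := Finset.mem_biUnion.1 hu
      exact Finset.mem_biUnion.2 ⟨i, hi, mem_descendants_of_apply_mem hui⟩
    rw [sum_excess, sub_nonpos, Nat.cast_le] at hsum
    refine (Finset.card_le_card fun i hi => ?_).trans hsum
    exact Finset.mem_filter.2
      ⟨Finset.mem_univ i, Finset.mem_biUnion.2 ⟨i, hi, self_mem_descendants f (s i)⟩⟩

end Hall

section Spitzer

variable {α M : Type*}

lemma natCard_subtype_prod {β γ : Type*} [Fintype β] [Finite γ] (P : β × γ → Prop) :
    Nat.card {x // P x} = ∑ b, Nat.card {c // P (b, c)} := by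
  rw [← Nat.card_sigma]
  exact Nat.card_congr (Equiv.subtypeProdEquivSigmaSubtype fun b c => P (b, c))

/-- The condition that, listing the elements of `α` by increasing rank `e`, all partial sums of
the weights are nonpositive. -/
def PrefixSumsNonpos [Fintype α] [AddCommMonoid M] [Preorder M] {n : ℕ} (e : α ≃ Fin n)
    (a : α → M) : Prop :=
  ∀ x, ∑ u with e u ≤ e x, a u ≤ 0

open Classical in
/-- The weights on `α` obtained from weights on `Option α` by letting `y` absorb the weight of
the extra element `none`; for `y = none` that weight is discarded. -/
noncomputable def mergeWeight [AddCommMonoid M] (a : Option α → M) (y : Option α) (u : α) : M :=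
  a (some u) + if y = some u then a none else 0

lemma sum_eq_sum_mergeWeight [AddCommMonoid M] {a : Option α → M} {y : Option α}
    {T : Finset (Option α)} {U : Finset α} (hsome : ∀ u, some u ∈ T ↔ u ∈ U)
    (hnone : none ∈ T ↔ ∃ u ∈ U, y = some u) :
    ∑ z ∈ T, a z = ∑ u ∈ U, mergeWeight a y u := by
  classical
  have hmerged : (∑ u ∈ U, if y = some u then a none else 0) = if none ∈ T then a none else 0 := by
    cases y <;> simp_all
  simp only [mergeWeight, Finset.sum_add_distrib, hmerged]
  split_ifs with hT
  · have hTU : T = Finset.insertNone U := by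
      ext (_ | u) <;> simp [hT, hsome]
    rw [hTU, Finset.sum_insertNone, add_comm]
  · have hTU : T = U.map .some := by
      ext (_ | u) <;> simp [hT, hsome]
    simp [hTU]

section Route

open Classical in
/-- The map on `Option α` obtained from `f` by making every arrow into `y` pass through the extra
element `none`, which is a fixed point if `y = none`. -/
noncomputable def routeThroughNone (f : α → α) (y : Option α) : Option α → Option α
  | none => y
  | some u => if y = some (f u) then none else some (f u)

variable [Fintype α] {f : α → α} {y : Option α}

lemma mem_descendants_of_routeThroughNone {z : Option α} {v : α}
    (hz : z ∈ descendants (routeThroughNone f y) (some v)) (u : α)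
    (hu : z = some u ∨ z = none ∧ y = some u) : u ∈ descendants f v := by
  obtain ⟨k, hk⟩ := mem_descendants.1 hz
  induction k generalizing z u with
  | zero =>
    obtain rfl : z = some v := hk
    obtain rfl : v = u := by simpa using hu
    exact self_mem_descendants f v
  | succ k ih =>
    rw [iterate_succ_apply] at hk
    have hz' := mem_descendants.2 ⟨k, hk⟩
    rcases hu with rfl | ⟨rfl, rfl⟩
    · refine mem_descendants_of_apply_mem (ih hz' _ ?_ hk)
      simp only [routeThroughNone]
      split_ifs with hy <;> simp [hy]
    · exact ih hz' u (.inl rfl) hk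

lemma some_mem_descendants_routeThroughNone {u v : α} :
    some u ∈ descendants (routeThroughNone f y) (some v) ↔ u ∈ descendants f v := by
  refine ⟨fun h => mem_descendants_of_routeThroughNone h u (.inl rfl), fun h => ?_⟩
  obtain ⟨k, hk⟩ := mem_descendants.1 h
  induction k generalizing u with
  | zero =>
    obtain rfl : u = v := hk
    exact self_mem_descendants _ _
  | succ k ih =>
    have hfu : some (f u) ∈ descendants (routeThroughNone f y) (some v) :=
      ih (mem_descendants.2 ⟨k, hk⟩) hk
    by_cases hy : y = some (f u)
    · refine mem_descendants_of_apply_mem (mem_descendants_of_apply_mem ?_)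
      simpa [routeThroughNone, hy] using hfu
    · refine mem_descendants_of_apply_mem ?_
      simpa [routeThroughNone, hy] using hfu

lemma none_mem_descendants_routeThroughNone {v : α} :
    none ∈ descendants (routeThroughNone f y) (some v) ↔ ∃ u ∈ descendants f v, y = some u := by
  constructor
  · intro h
    cases y with
    | some u => exact ⟨u, mem_descendants_of_routeThroughNone h u (.inr ⟨rfl, rfl⟩), rfl⟩
    | none =>
      obtain ⟨k, hk⟩ := mem_descendants.1 h
      have hfixed : routeThroughNone f none none = none := rfl
      simp [iterate_fixed hfixed] at hk
  · rintro ⟨u, hu, rfl⟩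
    exact mem_descendants_of_apply_mem (some_mem_descendants_routeThroughNone.2 hu)

end Route

lemma coe_decomposeOption_symm [DecidableEq α] (y : Option α) (σ : Equiv.Perm α) :
    ⇑(Equiv.Perm.decomposeOption.symm (y, σ)) = routeThroughNone σ y := by
  funext z
  cases z with
  | none => simp [routeThroughNone]
  | some u =>
    simp only [Equiv.Perm.decomposeOption_symm_apply, Equiv.Perm.coe_mul, comp_apply,
      Equiv.optionCongr_apply, Option.map_some, Equiv.swap_apply_def, reduceCtorEq, if_false,
      routeThroughNone]
    congr 1
    exact propext eq_comm

section Perm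

variable [Fintype α]

lemma descendants_perm_apply (σ : Equiv.Perm α) (x : α) :
    descendants σ (σ x) = descendants σ x := by
  have hmem : x ∈ descendants σ (σ x) := mem_descendants.2 ⟨1, rfl⟩
  refine (descendants_subset (fun _ => mem_descendants_of_apply_mem) ?_).antisymm
    (descendants_subset (fun _ => mem_descendants_of_apply_mem) hmem)
  obtain ⟨k, hk, hperiod⟩ := Function.mem_periodicPts.1 (σ.injective.mem_periodicPts x)
  refine mem_descendants.2 ⟨k - 1, ?_⟩
  rw [← iterate_succ_apply, Nat.succ_eq_add_one, Nat.sub_add_cancel hk]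
  exact hperiod

variable [AddCommMonoid M]

lemma descendantSumsNonpos_option_iff [Preorder M] {τ : Equiv.Perm (Option α)}
    {a : Option α → M} (ha : a none ≤ 0) :
    DescendantSumsNonpos τ a ↔ ∀ v : α, ∑ z ∈ descendants τ (some v), a z ≤ 0 := by
  refine ⟨fun h v => h (some v), fun h => ?_⟩
  rintro (_ | v)
  · cases hτ : τ none with
    | none =>
      have : descendants τ none ⊆ {none} := descendants_subset
        (fun z hz => by simpa using τ.injective ((Finset.mem_singleton.1 hz).trans hτ.symm))
        (Finset.mem_singleton_self none)
      rw [this.antisymm (by simpa using self_mem_descendants τ none)]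
      simpa using ha
    | some v => simpa [← descendants_perm_apply τ none, hτ] using h v
  · exact h v

lemma descendantSumsNonpos_decomposeOption_symm [DecidableEq α] [Preorder M] {a : Option α → M}
    (ha : a none ≤ 0) (y : Option α) (σ : Equiv.Perm α) :
    DescendantSumsNonpos (Equiv.Perm.decomposeOption.symm (y, σ)) a ↔
      DescendantSumsNonpos σ (mergeWeight a y) := by
  rw [descendantSumsNonpos_option_iff ha]
  refine forall_congr' fun v => ?_
  rw [coe_decomposeOption_symm, sum_eq_sum_mergeWeight
    (fun _ => some_mem_descendants_routeThroughNone) none_mem_descendants_routeThroughNone]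

lemma natCard_descendantSumsNonpos_option [Preorder M] {a : Option α → M} (ha : a none ≤ 0) :
    Nat.card {σ : Equiv.Perm (Option α) // DescendantSumsNonpos σ a} =
      ∑ y, Nat.card {σ : Equiv.Perm α // DescendantSumsNonpos σ (mergeWeight a y)} := by
  classical
  rw [← natCard_subtype_prod fun p : Option α × Equiv.Perm α =>
    DescendantSumsNonpos p.2 (mergeWeight a p.1)]
  exact Nat.card_congr (Equiv.Perm.decomposeOption.symm.subtypeEquiv fun p =>
    (descendantSumsNonpos_decomposeOption_symm ha p.1 p.2).symm).symm

end Perm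

section Ranking

variable {n : ℕ}

lemma prefixSumsNonpos_option_iff [Fintype α] [AddCommMonoid M] [Preorder M] [AddLeftMono M]
    {e : Option α ≃ Fin (n + 1)} {a : Option α → M} (ha : a none ≤ 0) :
    PrefixSumsNonpos e a ↔ ∀ v : α, ∑ z with e z ≤ e (some v), a z ≤ 0 := by
  classical
  refine ⟨fun h v => h (some v), fun h => ?_⟩
  rintro (_ | v)
  · obtain hzero | ⟨j, hj⟩ := (e none).eq_zero_or_eq_succ
    · have hset : (Finset.univ.filter fun z => e z ≤ e none) = {none} := by
        ext z
        rw [Finset.mem_filter_univ, Finset.mem_singleton, hzero, Fin.le_zero_iff, ← hzero,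
          e.apply_eq_iff_eq]
      simpa [hset] using ha
    · obtain ⟨v, hv⟩ : ∃ v, e (some v) = j.castSucc := by
        obtain ⟨_ | v, hz⟩ := e.surjective j.castSucc
        · simp [hj, Fin.ext_iff] at hz
        · exact ⟨v, hz⟩
      have hset : (Finset.univ.filter fun z => e z ≤ e none) =
          insert none (Finset.univ.filter fun z => e z ≤ e (some v)) := by
        ext z
        rw [Finset.mem_insert, Finset.mem_filter_univ, Finset.mem_filter_univ,
          ← e.apply_eq_iff_eq, hv, hj]
        simp only [Fin.le_def, Fin.ext_iff, Fin.val_succ, Fin.val_castSucc]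
        omega
      rw [hset, Finset.sum_insert (by simp [hv, hj, Fin.le_def])]
      exact add_nonpos ha (h v)
  · exact h v

lemma optionCongr_removeNone {β : Type*} {e : Option α ≃ Option β} (h : e none = none) :
    (Equiv.removeNone e).optionCongr = e := by
  refine Equiv.ext fun z => ?_
  cases z with
  | none => exact h.symm
  | some x =>
    refine Equiv.removeNone_some e (Option.ne_none_iff_exists'.1 fun hx => ?_)
    exact Option.some_ne_none x (e.injective (hx.trans h.symm))

/-- Inserting an extra element `none` into a ranking of `α`, immediately before the element `y`,
or at the end for `y = none`. -/
def insertRank : Option α × (α ≃ Fin n) ≃ (Option α ≃ Fin (n + 1)) where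
  toFun p :=
    p.2.optionCongr.trans (finSuccEquiv' (finSuccEquivLast.symm (p.2.optionCongr p.1))).symm
  invFun e :=
    let e' := Equiv.removeNone (e.trans (finSuccEquiv' (e none)))
    (e'.optionCongr.symm (finSuccEquivLast (e none)), e')
  left_inv := by
    rintro ⟨y, e⟩
    have hnone (i : Fin (n + 1)) : (e.optionCongr.trans (finSuccEquiv' i).symm) none = i := by simp
    simp only [hnone, Equiv.trans_assoc, Equiv.symm_trans_self, Equiv.trans_refl,
      Equiv.removeNone_optionCongr, Equiv.apply_symm_apply, Equiv.symm_apply_apply]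
  right_inv e := by
    simp only [Equiv.apply_symm_apply, Equiv.symm_apply_apply]
    rw [optionCongr_removeNone (by simp), Equiv.trans_assoc, Equiv.self_trans_symm,
      Equiv.trans_refl]

lemma insertRank_none (y : Option α) (e : α ≃ Fin n) :
    insertRank (y, e) none = finSuccEquivLast.symm (y.map e) := by
  simp [insertRank]

lemma insertRank_some (y : Option α) (e : α ≃ Fin n) (u : α) :
    insertRank (y, e) (some u) = (insertRank (y, e) none).succAbove (e u) := by
  simp [insertRank]

lemma insertRank_none_le_some {y : Option α} {e : α ≃ Fin n} {v : α} :
    insertRank (y, e) none ≤ insertRank (y, e) (some v) ↔ ∃ u, e u ≤ e v ∧ y = some u := by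
  rw [insertRank_some, (Fin.ne_succAbove _ _).le_iff_lt, Fin.lt_succAbove_iff_le_castSucc,
    insertRank_none]
  cases y with
  | none => simp
  | some u => simp

variable [Fintype α] [AddCommMonoid M] [Preorder M]

lemma prefixSumsNonpos_insertRank [AddLeftMono M] {a : Option α → M} (ha : a none ≤ 0)
    (y : Option α) (e : α ≃ Fin n) :
    PrefixSumsNonpos (insertRank (y, e)) a ↔ PrefixSumsNonpos e (mergeWeight a y) := by
  rw [prefixSumsNonpos_option_iff ha]
  refine forall_congr' fun v => ?_
  rw [sum_eq_sum_mergeWeight (U := {u | e u ≤ e v})]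
  · intro u
    simp [insertRank_some]
  · simp [insertRank_none_le_some]

lemma natCard_prefixSumsNonpos_option [AddLeftMono M] {a : Option α → M} (ha : a none ≤ 0) :
    Nat.card {e : Option α ≃ Fin (n + 1) // PrefixSumsNonpos e a} =
      ∑ y, Nat.card {e : α ≃ Fin n // PrefixSumsNonpos e (mergeWeight a y)} := by
  rw [← natCard_subtype_prod fun p : Option α × (α ≃ Fin n) =>
    PrefixSumsNonpos p.2 (mergeWeight a p.1)]
  exact Nat.card_congr (insertRank.subtypeEquiv fun p =>
    (prefixSumsNonpos_insertRank ha p.1 p.2).symm).symm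

end Ranking

section Transport

variable {β : Type*} [Fintype α] [Fintype β]

lemma descendants_conj (ε : α ≃ β) (f : α → α) (x : β) :
    descendants (ε ∘ f ∘ ε.symm) x = (descendants f (ε.symm x)).map ε.toEmbedding := by
  ext u
  have hiter (k : ℕ) : (ε ∘ f ∘ ε.symm)^[k] u = ε (f^[k] (ε.symm u)) := by
    have hsemi : Semiconj ε f (ε ∘ f ∘ ε.symm) := fun v => by simp
    rw [hsemi.iterate_right k, ε.apply_symm_apply]
  simp [hiter, Equiv.eq_symm_apply, Finset.mem_map_equiv]

variable [AddCommMonoid M] [Preorder M]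

lemma descendantSumsNonpos_conj (ε : α ≃ β) {f : α → α} {a : β → M} :
    DescendantSumsNonpos (ε ∘ f ∘ ε.symm) a ↔ DescendantSumsNonpos f (a ∘ ε) := by
  simp only [DescendantSumsNonpos, descendants_conj, Finset.sum_map]
  exact ε.symm.forall_congr fun _ => Iff.rfl

lemma natCard_descendantSumsNonpos_congr (ε : α ≃ β) (a : β → M) :
    Nat.card {σ : Equiv.Perm β // DescendantSumsNonpos σ a} =
      Nat.card {σ : Equiv.Perm α // DescendantSumsNonpos σ (a ∘ ε)} :=
  (Nat.card_congr (ε.permCongr.subtypeEquiv fun _ => (descendantSumsNonpos_conj ε).symm)).symm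

lemma natCard_prefixSumsNonpos_congr (ε : α ≃ β) (a : β → M) {n : ℕ} :
    Nat.card {e : β ≃ Fin n // PrefixSumsNonpos e a} =
      Nat.card {e : α ≃ Fin n // PrefixSumsNonpos e (a ∘ ε)} := by
  refine Nat.card_congr ((ε.symm.equivCongr (.refl (Fin n))).subtypeEquiv fun e => ?_)
  refine ε.symm.forall_congr fun x => ?_
  rw [Finset.sum_equiv (t := {u | e (ε u) ≤ e x}) (g := a ∘ ε) ε.symm (by simp) (by simp)]
  simp

end Transport

theorem natCard_prefixSumsNonpos_eq_natCard_descendantSumsNonpos [Fintype α]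
    [AddCommMonoid M] [LinearOrder M] [IsOrderedAddMonoid M] {n : ℕ} (hn : Fintype.card α = n)
    (a : α → M) :
    Nat.card {e : α ≃ Fin n // PrefixSumsNonpos e a} =
      Nat.card {σ : Equiv.Perm α // DescendantSumsNonpos σ a} := by
  classical
  induction n generalizing α with
  | zero =>
    have := Fintype.card_eq_zero_iff.1 hn
    let ε : Fin 0 ≃ α := .equivOfIsEmpty _ _
    exact Nat.card_congr ((Equiv.equivCongr (.refl α) ε).subtypeEquiv fun e =>
      iff_of_true isEmptyElim isEmptyElim)
  | succ n ih =>
    by_cases hpos : ∀ x, 0 < a x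
    · obtain ⟨x⟩ : Nonempty α := Fintype.card_pos_iff.1 (by omega)
      have hsum {U : Finset α} (hx : x ∈ U) : ¬ ∑ u ∈ U, a u ≤ 0 :=
        fun h => (hpos x).not_ge ((Finset.single_le_sum (fun u _ => (hpos u).le) hx).trans h)
      rw [Nat.card_eq_zero.2 (.inl ⟨fun e => hsum (by simp) (e.2 x)⟩),
        Nat.card_eq_zero.2 (.inl ⟨fun σ => hsum (self_mem_descendants _ x) (σ.2 x)⟩)]
    · push Not at hpos
      obtain ⟨x, hx⟩ := hpos
      let ε := Equiv.optionSubtypeNe x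
      have hcard : Fintype.card {u // u ≠ x} = n := by simp [hn]
      rw [natCard_prefixSumsNonpos_congr ε, natCard_descendantSumsNonpos_congr ε,
        natCard_prefixSumsNonpos_option hx, natCard_descendantSumsNonpos_option hx]
      exact Finset.sum_congr rfl fun y _ => ih hcard (mergeWeight (a ∘ ε) y)

end Spitzer

section Path

variable {α : Type*} {f : α → α} {v : α} {n : ℕ}

/-- `f` is the parent map of a path rooted at one end and starting at the other end `v`. -/
def IsPath (f : α → α) (v : α) : Prop :=
  (∀ x, ∃ k, f^[k] v = x) ∧ ∃ r, f r = r

lemma IsPath.surjective_iterate [Fintype α] (hf : IsPath f v) (hn : Fintype.card α = n) :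
    Surjective fun i : Fin n => f^[i] v := by
  classical
  intro x
  have hx := hf.1 x
  suffices Nat.find hx < n from ⟨⟨Nat.find hx, this⟩, Nat.find_spec hx⟩
  have hinj : Injective fun i : Fin (Nat.find hx + 1) => f^[i] v := by
    refine .of_lt_imp_ne fun i j hij heq => Nat.find_min hx (m := Nat.find hx - j + i) (by omega) ?_
    rw [iterate_add_apply, heq, ← iterate_add_apply, Nat.sub_add_cancel (by omega)]
    exact Nat.find_spec hx
  simpa [hn] using Fintype.card_le_of_injective _ hinj

lemma IsPath.apply_iterate_eq [Fintype α] (hf : IsPath f v) (hn : Fintype.card α = n + 1) :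
    f (f^[n] v) = f^[n] v := by
  obtain ⟨r, hr⟩ := hf.2
  obtain ⟨i, hi : f^[i] v = r⟩ := hf.surjective_iterate hn r
  have hend : f^[n] v = r := by
    rw [← Nat.sub_add_cancel (Nat.le_of_lt_succ i.2), iterate_add_apply, hi, iterate_fixed hr]
  rw [hend, hr]

/-- The map sending each element to the next one in the ranking `e`, and the last to itself. -/
def nextMap (e : α ≃ Fin (n + 1)) : α → α :=
  e.symm ∘ Order.succ ∘ e

lemma iterate_nextMap (e : α ≃ Fin (n + 1)) (k : ℕ) (x : α) :
    (nextMap e)^[k] x = e.symm (Order.succ^[k] (e x)) := by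
  have hsemi : Semiconj e.symm Order.succ (nextMap e) := fun i => by simp [nextMap]
  rw [hsemi.iterate_right k, e.symm_apply_apply]

lemma exists_iterate_nextMap_iff {e : α ≃ Fin (n + 1)} {x y : α} :
    (∃ k, (nextMap e)^[k] x = y) ↔ e x ≤ e y := by
  simp [iterate_nextMap, Equiv.symm_apply_eq, exists_succ_iterate_iff_le]

lemma iterate_nextMap_first (e : α ≃ Fin (n + 1)) (i : Fin (n + 1)) :
    (nextMap e)^[i] (e.symm 0) = e.symm i := by
  induction i using Fin.induction with
  | zero => rfl
  | succ i ih =>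
    rw [Fin.val_castSucc] at ih
    rw [Fin.val_succ, iterate_succ_apply', ih]
    simp [nextMap]

lemma isPath_nextMap (e : α ≃ Fin (n + 1)) : IsPath (nextMap e) (e.symm 0) :=
  ⟨fun x => exists_iterate_nextMap_iff.2 (by simp),
    e.symm (Fin.last n), by simp [nextMap]⟩

lemma IsPath.exists_ranking [Fintype α] (hf : IsPath f v) (hn : Fintype.card α = n + 1) :
    ∃ e : α ≃ Fin (n + 1), e.symm 0 = v ∧ nextMap e = f := by
  let g : Fin (n + 1) → α := fun i => f^[i] v
  have hg : Bijective g := (Fintype.bijective_iff_surjective_and_card g).2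
    ⟨hf.surjective_iterate hn, by simp [hn]⟩
  refine ⟨(Equiv.ofBijective g hg).symm, rfl, funext fun x => ?_⟩
  obtain ⟨i, rfl⟩ := hg.surjective x
  have hg_symm : (Equiv.ofBijective g hg).symm (g i) = i :=
    Equiv.ofBijective_symm_apply_apply g hg i
  suffices g (Order.succ i) = f (g i) by simpa [nextMap, hg_symm] using this
  cases i using Fin.lastCases with
  | last => simpa [g] using (hf.apply_iterate_eq hn).symm
  | cast i => simp [g, iterate_succ_apply']

/-- Rankings correspond to paths with a marked starting point. -/
noncomputable def rankingEquivPath [Fintype α] (hn : Fintype.card α = n + 1) :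
    (α ≃ Fin (n + 1)) ≃ {p : α × (α → α) // IsPath p.2 p.1} :=
  Equiv.ofBijective (fun e => ⟨(e.symm 0, nextMap e), isPath_nextMap e⟩) <| by
    constructor
    · intro e e' h
      have hv : e.symm 0 = e'.symm 0 := congrArg (·.1.1) h
      have hf : nextMap e = nextMap e' := congrArg (·.1.2) h
      rw [← Equiv.symm_bijective.injective.eq_iff]
      ext i
      rw [← iterate_nextMap_first, hv, hf, iterate_nextMap_first]
    · rintro ⟨⟨v, f⟩, hf⟩
      obtain ⟨e, rfl, rfl⟩ := IsPath.exists_ranking hf hn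
      exact ⟨e, rfl⟩

variable [Fintype α] {M : Type*} [AddCommMonoid M]

lemma descendantSumsNonpos_nextMap [Preorder M] {e : α ≃ Fin (n + 1)} {a : α → M} :
    DescendantSumsNonpos (nextMap e) a ↔ PrefixSumsNonpos e a := by
  classical
  simp only [DescendantSumsNonpos, PrefixSumsNonpos, descendants, exists_iterate_nextMap_iff]

theorem sum_natCard_isPath_eq_natCard_bijective [Nonempty α] [LinearOrder M] [IsOrderedAddMonoid M]
    (a : α → M) :
    ∑ v, Nat.card {f : α → α // IsPath f v ∧ DescendantSumsNonpos f a} =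
      Nat.card {f : α → α // Bijective f ∧ DescendantSumsNonpos f a} := by
  obtain ⟨n, hn⟩ := Nat.exists_eq_succ_of_ne_zero (Fintype.card_ne_zero (α := α))
  calc
    ∑ v, Nat.card {f : α → α // IsPath f v ∧ DescendantSumsNonpos f a}
    _ = Nat.card {e : α ≃ Fin (n + 1) // PrefixSumsNonpos e a} := by
      rw [← natCard_subtype_prod fun p : α × (α → α) => IsPath p.2 p.1 ∧ DescendantSumsNonpos p.2 a]
      refine Nat.card_congr (.trans (Equiv.subtypeSubtypeEquivSubtypeInter _ _).symm ?_)
      exact ((rankingEquivPath hn).subtypeEquiv fun e => descendantSumsNonpos_nextMap.symm).symm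
    _ = Nat.card {σ : Equiv.Perm α // DescendantSumsNonpos σ a} :=
      natCard_prefixSumsNonpos_eq_natCard_descendantSumsNonpos hn a
    _ = Nat.card {f : α → α // Bijective f ∧ DescendantSumsNonpos f a} := by
      refine Nat.card_congr (.trans ?_ (Equiv.subtypeSubtypeEquivSubtypeInter _ _))
      exact Equiv.bijectiveEquiv.symm.subtypeEquiv fun σ => Iff.rfl

end Path

section Decomposition

variable {V : Type*} {f g : V → V} {S : Set V}

/-- `S` is invariant under `f` and every orbit of `f` enters `S`, so that `f` consists of a self-map
of `S` with a forest attached to it. -/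
structure IsAbsorbing (f : V → V) (S : Set V) : Prop where
  mapsTo : Set.MapsTo f S S
  exists_iterate_mem : ∀ u, ∃ k, f^[k] u ∈ S

/-- `f` is the parent map of a rooted forest with set of roots `S`, where each root is its own
parent. -/
structure IsForestMap (f : V → V) (S : Set V) : Prop where
  apply_root : ∀ r ∈ S, f r = r
  exists_iterate_mem : ∀ u, ∃ k, f^[k] u ∈ S

lemma IsForestMap.isAbsorbing (hg : IsForestMap g S) : IsAbsorbing g S :=
  ⟨fun r hr => (hg.apply_root r hr).symm ▸ hr, hg.exists_iterate_mem⟩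

lemma exists_iterate_mem_congr (h : Set.EqOn f g Sᶜ) (hg : ∀ u, ∃ k, g^[k] u ∈ S) (u : V) :
    ∃ k, f^[k] u ∈ S := by
  obtain ⟨k, hk⟩ := hg u
  induction k generalizing u with
  | zero => exact ⟨0, hk⟩
  | succ k ih =>
    by_cases hu : u ∈ S
    · exact ⟨0, hu⟩
    · obtain ⟨l, hl⟩ := ih (g u) hk
      exact ⟨l + 1, by rwa [iterate_succ_apply, h hu]⟩

open Classical in
/-- The map equal to `h` on `S` and to `g` elsewhere. -/
noncomputable def graft (g : V → V) (h : S → S) (v : V) : V :=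
  if hv : v ∈ S then h ⟨v, hv⟩ else g v

lemma graft_coe (g : V → V) (h : S → S) (x : S) : graft g h x = h x := by
  simp [graft]

lemma eqOn_graft (g : V → V) (h : S → S) : Set.EqOn (graft g h) g Sᶜ := fun v hv => by
  simp [graft, show v ∉ S from hv]

lemma iterate_graft_coe (g : V → V) (h : S → S) (k : ℕ) (x : S) :
    (graft g h)^[k] x = (h^[k] x : S) :=
  ((show Semiconj ((↑) : S → V) h (graft g h) from fun y => (graft_coe g h y).symm).iterate_right
    k x).symm

lemma IsForestMap.isAbsorbing_graft (hg : IsForestMap g S) (h : S → S) :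
    IsAbsorbing (graft g h) S :=
  ⟨fun v hv => by simpa only [graft_coe] using (graft_coe g h ⟨v, hv⟩) ▸ (h ⟨v, hv⟩).2,
    exists_iterate_mem_congr (eqOn_graft g h) hg.exists_iterate_mem⟩

lemma IsAbsorbing.isForestMap_piecewise [∀ v, Decidable (v ∈ S)] (hf : IsAbsorbing f S) :
    IsForestMap (S.piecewise id f) S :=
  ⟨fun _ hr => S.piecewise_eq_of_mem _ _ hr, exists_iterate_mem_congr
    (fun _ hv => S.piecewise_eq_of_notMem _ _ hv) hf.exists_iterate_mem⟩

open Classical in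
/-- A map absorbed by `S` splits into the forest of the vertices outside `S`, rooted at `S`, and
its restriction to `S`. -/
noncomputable def graftEquiv (S : Set V) :
    {g : V → V // IsForestMap g S} × (S → S) ≃ {f : V → V // IsAbsorbing f S} where
  toFun p := ⟨graft p.1.1 p.2, p.1.2.isAbsorbing_graft p.2⟩
  invFun f := (⟨S.piecewise id f.1, f.2.isForestMap_piecewise⟩, f.2.mapsTo.restrict)
  left_inv := by
    rintro ⟨⟨g, hg⟩, h⟩
    refine Prod.ext (Subtype.ext (funext fun v => ?_)) (funext fun x => Subtype.ext ?_)
    · by_cases hv : v ∈ S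
      · simp [hv, hg.apply_root v hv]
      · simp [hv, graft]
    · exact graft_coe g h x
  right_inv f := by
    refine Subtype.ext (funext fun v => ?_)
    by_cases hv : v ∈ S <;> simp [graft, hv]

lemma iterate_eq_of_eqOn_compl (h : Set.EqOn f g Sᶜ) (hf : Set.MapsTo f S S) {u v : V}
    (hv : v ∉ S) {k : ℕ} (hk : f^[k] u = v) : g^[k] u = v := by
  induction k generalizing u with
  | zero => exact hk
  | succ k ih =>
    have hu : u ∉ S := fun hu => hv (hk ▸ hf.iterate (k + 1) hu)
    rw [iterate_succ_apply, ← h hu]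
    exact ih hk

variable [Fintype V]

lemma descendants_congr_of_notMem (h : Set.EqOn f g Sᶜ) (hf : Set.MapsTo f S S)
    (hg : Set.MapsTo g S S) {v : V} (hv : v ∉ S) : descendants f v = descendants g v := by
  ext u
  simp only [mem_descendants]
  exact exists_congr fun k => ⟨iterate_eq_of_eqOn_compl h hf hv,
    iterate_eq_of_eqOn_compl h.symm hg hv⟩

lemma descendants_graft_of_notMem (hg : IsForestMap g S) (h : S → S) {v : V} (hv : v ∉ S) :
    descendants (graft g h) v = descendants g v :=
  descendants_congr_of_notMem (eqOn_graft g h) (hg.isAbsorbing_graft h).mapsTo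
    hg.isAbsorbing.mapsTo hv

lemma IsForestMap.pairwiseDisjoint_descendants (hg : IsForestMap g S) (T : Set S) :
    T.PairwiseDisjoint fun y => descendants g y := by
  intro x _ y _ hxy
  refine Finset.disjoint_left.2 fun u hux huy => hxy (Subtype.ext ?_)
  obtain ⟨k, hk⟩ := mem_descendants.1 hux
  obtain ⟨l, hl⟩ := mem_descendants.1 huy
  rw [← iterate_fixed (hg.apply_root x x.2) l, ← iterate_fixed (hg.apply_root y y.2) k, ← hk, ← hl,
    ← iterate_add_apply, ← iterate_add_apply, add_comm]

variable [Fintype S]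

lemma descendants_graft_coe [DecidableEq V] (hg : IsForestMap g S) (h : S → S) (x : S) :
    descendants (graft g h) x = (descendants h x).biUnion fun y => descendants g y := by
  refine subset_antisymm (descendants_subset (fun u hu => ?_) ?_)
    (Finset.biUnion_subset.2 fun y hy => descendants_subset (fun u hu => ?_) ?_)
  · obtain ⟨y, hy, huy⟩ := Finset.mem_biUnion.1 hu
    by_cases huS : u ∈ S
    · lift u to S using huS
      rw [graft_coe, mem_descendants] at huy
      obtain ⟨k, hk⟩ := huy
      obtain rfl : h u = y := by
        rwa [iterate_fixed (hg.apply_root _ (h u).2), Subtype.coe_inj] at hk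
      exact Finset.mem_biUnion.2
        ⟨u, mem_descendants_of_apply_mem hy, self_mem_descendants g u⟩
    · rw [eqOn_graft g h huS] at huy
      exact Finset.mem_biUnion.2 ⟨y, hy, mem_descendants_of_apply_mem huy⟩
  · exact Finset.mem_biUnion.2 ⟨x, self_mem_descendants h x, self_mem_descendants g x⟩
  · by_cases huS : u ∈ S
    · rwa [hg.apply_root u huS] at hu
    · exact mem_descendants_of_apply_mem (eqOn_graft g h huS ▸ hu)
  · obtain ⟨k, rfl⟩ := mem_descendants.1 hy
    exact mem_descendants.2 ⟨k, iterate_graft_coe g h k y⟩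

variable {M : Type*} [AddCommMonoid M]

/-- The total weight of the tree of `g` rooted at `x`. -/
noncomputable def treeSum (g : V → V) (w : V → M) (x : S) : M := ∑ u ∈ descendants g x, w u

lemma descendantSumsNonpos_graft_iff [Preorder M] (hg : IsForestMap g S) (h : S → S) (w : V → M) :
    DescendantSumsNonpos (graft g h) w ↔
      (∀ v ∉ S, ∑ u ∈ descendants g v, w u ≤ 0) ∧ DescendantSumsNonpos h (treeSum g w) := by
  classical
  have hroot (x : S) : ∑ u ∈ descendants (graft g h) x, w u =
      ∑ y ∈ descendants h x, treeSum g w y := by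
    rw [descendants_graft_coe hg, Finset.sum_biUnion (hg.pairwiseDisjoint_descendants _)]
    rfl
  constructor
  · refine fun H => ⟨fun v hv => ?_, fun x => ?_⟩
    · exact descendants_graft_of_notMem hg h hv ▸ H v
    · exact hroot x ▸ H x
  · rintro ⟨hforest, hS⟩ v
    by_cases hv : v ∈ S
    · exact (hroot ⟨v, hv⟩).trans_le (hS ⟨v, hv⟩)
    · rw [descendants_graft_of_notMem hg h hv]
      exact hforest v hv

end Decomposition

section Joyal

variable {V : Type*} {f : V → V} {S : Set V} {v : V}

lemma exists_iterate_mem_periodicPts [Finite V] (f : V → V) (u : V) :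
    ∃ k, f^[k] u ∈ periodicPts f := by
  obtain ⟨k, l, hlt, heq⟩ : ∃ k l, k < l ∧ f^[k] u = f^[l] u := by
    obtain ⟨k, l, hne, heq⟩ := Finite.exists_ne_map_eq_of_infinite fun k : ℕ => f^[k] u
    rcases hne.lt_or_gt with h | h
    exacts [⟨k, l, h, heq⟩, ⟨l, k, h, heq.symm⟩]
  refine ⟨k, mk_mem_periodicPts (Nat.sub_pos_of_lt hlt) ?_⟩
  rw [IsPeriodicPt, IsFixedPt, ← iterate_add_apply, Nat.sub_add_cancel hlt.le, heq]

lemma IsAbsorbing.periodicPts_subset (hf : IsAbsorbing f S) : periodicPts f ⊆ S := by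
  intro v hv
  obtain ⟨n, hn, hper⟩ := mem_periodicPts.1 hv
  obtain ⟨k, hk⟩ := hf.exists_iterate_mem v
  have hmem := hf.mapsTo.iterate (n * k - k) hk
  rwa [← iterate_add_apply, Nat.sub_add_cancel (Nat.le_mul_of_pos_left k hn), hper.mul_const k]
    at hmem

lemma periodicPts_eq_iff [Finite V] :
    periodicPts f = S ↔ ∃ hf : IsAbsorbing f S, Bijective hf.mapsTo.restrict := by
  constructor
  · rintro rfl
    exact ⟨⟨(bijOn_periodicPts f).mapsTo, exists_iterate_mem_periodicPts f⟩,
      (bijOn_periodicPts f).bijective⟩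
  · rintro ⟨hf, hbij⟩
    refine hf.periodicPts_subset.antisymm fun v hv => ?_
    have hsemi : Semiconj ((↑) : S → V) hf.mapsTo.restrict f := fun _ => rfl
    exact hsemi.mapsTo_periodicPts (hbij.injective.mem_periodicPts ⟨v, hv⟩)

/-- `f` is the parent map of a rooted tree, where the root is its own parent. -/
def IsTreeMap (f : V → V) : Prop :=
  ∃ r, IsForestMap f {r}

/-- The forward orbit of `v` under `f`. For the parent map of a tree, it is the spine of Joyal's
bijection: the path from `v` to the root. -/
def orbit (f : V → V) (v : V) : Set V :=
  {x | ∃ k, f^[k] v = x}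

lemma isTreeMap_and_orbit_eq_iff :
    IsTreeMap f ∧ orbit f v = S ↔
      ∃ hf : IsAbsorbing f S, ∃ hv : v ∈ S, IsPath hf.mapsTo.restrict ⟨v, hv⟩ := by
  constructor
  · rintro ⟨⟨r, hr⟩, rfl⟩
    obtain ⟨i, hi : f^[i] v = r⟩ := hr.exists_iterate_mem v
    have hmaps : Set.MapsTo f (orbit f v) (orbit f v) := by
      rintro _ ⟨k, rfl⟩
      exact ⟨k + 1, iterate_succ_apply' f k v⟩
    refine ⟨⟨hmaps, fun u => ?_⟩, ⟨0, rfl⟩, ?_, ⟨r, i, hi⟩, Subtype.ext (hr.apply_root r rfl)⟩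
    · obtain ⟨k, hk : f^[k] u = r⟩ := hr.exists_iterate_mem u
      exact ⟨k, i, hi.trans hk.symm⟩
    · rintro ⟨_, k, rfl⟩
      exact ⟨k, Subtype.ext (by rw [hmaps.iterate_restrict]; rfl)⟩
  · rintro ⟨hf, hv, hpath, r, hr⟩
    have hreach (x : S) : ∃ k, f^[k] v = x := by
      obtain ⟨k, rfl⟩ := hpath x
      exact ⟨k, by rw [hf.mapsTo.iterate_restrict]; rfl⟩
    have hroot : f r = r := congrArg Subtype.val hr
    refine ⟨⟨r, by rintro _ rfl; exact hroot, fun u => ?_⟩, Set.Subset.antisymm ?_ fun x hx => ?_⟩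
    · obtain ⟨k, hk⟩ := hf.exists_iterate_mem u
      obtain ⟨i, hi : f^[i] v = f^[k] u⟩ := hreach ⟨f^[k] u, hk⟩
      obtain ⟨j, hj⟩ := hreach r
      refine ⟨j + k, ?_⟩
      rw [iterate_add_apply, ← hi, ← iterate_add_apply, add_comm, iterate_add_apply, hj,
        iterate_fixed hroot]
      rfl
    · rintro _ ⟨k, rfl⟩
      exact hf.mapsTo.iterate k hv
    · exact hreach ⟨x, hx⟩

lemma natCard_eq_sum_natCard_fiber {α β : Type*} [Finite α] [Fintype β] (P : α → Prop)
    (F : α → β) : Nat.card {x // P x} = ∑ b, Nat.card {x // P x ∧ F x = b} := by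
  rw [← Nat.card_congr (Equiv.sigmaFiberEquiv fun x : {x // P x} => F x), Nat.card_sigma]
  exact Finset.sum_congr rfl fun b _ =>
    Nat.card_congr (Equiv.subtypeSubtypeEquivSubtypeInter P fun x => F x = b)

variable [Fintype V] {M : Type*} [AddCommMonoid M]

open Classical in
lemma natCard_isAbsorbing_eq_sum [Preorder M] (S : Set V) (Q : (S → S) → Prop) (w : V → M) :
    Nat.card {f : V → V // (∃ hf : IsAbsorbing f S, Q hf.mapsTo.restrict) ∧
      DescendantSumsNonpos f w} =
    ∑ g : {g : V → V // IsForestMap g S},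
      Nat.card {h : S → S // Q h ∧ DescendantSumsNonpos (graft g h) w} := by
  rw [← natCard_subtype_prod fun p : {g : V → V // IsForestMap g S} × (S → S) =>
    Q p.2 ∧ DescendantSumsNonpos (graft p.1 p.2) w]
  simp only [← exists_and_right]
  refine Nat.card_congr ((Equiv.subtypeSubtypeEquivSubtypeExists _
    fun f : {f : V → V // IsAbsorbing f S} =>
      Q f.2.mapsTo.restrict ∧ DescendantSumsNonpos f.1 w).symm.trans ?_)
  refine ((graftEquiv S).subtypeEquiv fun p => ?_).symm
  have hrestrict : (graftEquiv S p).2.mapsTo.restrict = p.2 :=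
    congrArg Prod.snd ((graftEquiv S).left_inv p)
  exact and_congr_left' (by rw [hrestrict])

variable [LinearOrder M] [IsOrderedAddMonoid M]

lemma sum_natCard_isPath_graft_eq_natCard_bijective_graft {g : V → V} [Fintype S] [Nonempty S]
    (hg : IsForestMap g S) (w : V → M) :
    ∑ x, Nat.card {h : S → S // IsPath h x ∧ DescendantSumsNonpos (graft g h) w} =
      Nat.card {h : S → S // Bijective h ∧ DescendantSumsNonpos (graft g h) w} := by
  simp only [descendantSumsNonpos_graft_iff hg]
  by_cases hforest : ∀ v ∉ S, ∑ u ∈ descendants g v, w u ≤ 0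
  · simpa only [and_iff_right hforest] using
      sum_natCard_isPath_eq_natCard_bijective (α := S) (treeSum g w)
  · simp [hforest]

lemma sum_natCard_orbit_eq_natCard_periodicPts [Nonempty V] (S : Set V) (w : V → M) :
    ∑ v, Nat.card {f : V → V // (IsTreeMap f ∧ orbit f v = S) ∧ DescendantSumsNonpos f w} =
      Nat.card {f : V → V // periodicPts f = S ∧ DescendantSumsNonpos f w} := by
  classical
  simp only [isTreeMap_and_orbit_eq_iff, periodicPts_eq_iff]
  rw [Finset.sum_congr_set S _ (fun x : S => Nat.card {f : V → V //
    (∃ hf : IsAbsorbing f S, IsPath hf.mapsTo.restrict x) ∧ DescendantSumsNonpos f w})]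
  · rw [natCard_isAbsorbing_eq_sum S Bijective w, Finset.sum_congr rfl fun x _ =>
      natCard_isAbsorbing_eq_sum S (fun h => IsPath h x) w, Finset.sum_comm]
    refine Finset.sum_congr rfl fun g _ => ?_
    obtain ⟨k, hk⟩ := g.2.exists_iterate_mem (Classical.arbitrary V)
    have : Nonempty S := ⟨⟨_, hk⟩⟩
    exact sum_natCard_isPath_graft_eq_natCard_bijective_graft g.2 w
  · intro v hv
    simp [hv]
  · intro v hv
    simp [hv]

theorem card_mul_natCard_isTreeMap [Nonempty V] (w : V → M) :
    Fintype.card V * Nat.card {f : V → V // IsTreeMap f ∧ DescendantSumsNonpos f w} =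
      Nat.card {f : V → V // DescendantSumsNonpos f w} := by
  classical
  calc
    Fintype.card V * Nat.card {f : V → V // IsTreeMap f ∧ DescendantSumsNonpos f w}
    _ = ∑ v : V, ∑ S : Set V, Nat.card {f : V → V //
          (IsTreeMap f ∧ DescendantSumsNonpos f w) ∧ orbit f v = S} := by
      simp only [← natCard_eq_sum_natCard_fiber, Finset.sum_const, Finset.card_univ, smul_eq_mul]
    _ = ∑ S : Set V, Nat.card {f : V → V // DescendantSumsNonpos f w ∧ periodicPts f = S} := by
      rw [Finset.sum_comm]
      refine Finset.sum_congr rfl fun S _ => ?_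
      simpa only [and_assoc, and_left_comm, and_comm] using
        sum_natCard_orbit_eq_natCard_periodicPts S w
    _ = Nat.card {f : V → V // DescendantSumsNonpos f w} :=
      (natCard_eq_sum_natCard_fiber _ _).symm

end Joyal

section ParentDigraph

variable {V : Type*} {D : Digraph V} {f g : V → V} {r v : V}

/-- Apart from loops, the edges of `D` go to each vertex `v` from its parent `f v`. -/
def HasParentMap (D : Digraph V) (f : V → V) : Prop :=
  ∀ u v, u ≠ v → (D.Adj u v ↔ f v = u)

lemma HasParentMap.unique (hf : HasParentMap D f) (hg : HasParentMap D g) : f = g := by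
  funext v
  by_cases hv : f v = v
  · by_contra hne
    have hgv : g v ≠ v := fun h => hne (hv.trans h.symm)
    exact hne ((hf _ _ hgv).1 ((hg _ _ hgv).2 rfl))
  · exact ((hg _ _ hv).1 ((hf _ _ hv).2 rfl)).symm

lemma HasParentMap.reflTransGen_iff (hf : HasParentMap D f) (u v : V) :
    ReflTransGen D.Adj u v ↔ ∃ k, f^[k] v = u := by
  constructor
  · intro h
    induction h with
    | refl => exact ⟨0, rfl⟩
    | @tail b c _ hbc ih =>
      obtain ⟨k, hk⟩ := ih
      by_cases hne : b = c
      · exact ⟨k, hne ▸ hk⟩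
      · exact ⟨k + 1, by rw [iterate_succ_apply, (hf b c hne).1 hbc, hk]⟩
  · rintro ⟨k, rfl⟩
    induction k generalizing v with
    | zero => exact .refl
    | succ k ih =>
      by_cases hne : f v = v
      · rw [iterate_fixed hne]
      · exact (ih (f v)).tail ((hf _ _ hne).2 rfl)

/-- The loopless digraph with an edge to each vertex from its parent. -/
def childDigraph (f : V → V) : Digraph V where
  Adj u v := f v = u ∧ u ≠ v

lemma hasParentMap_childDigraph (f : V → V) : HasParentMap (childDigraph f) f :=
  fun _ _ hne => and_iff_left hne

lemma hasParentMap_reverse_mappingDigraph (f : V → V) :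
    HasParentMap (reverse (mappingDigraph f)) f :=
  fun _ _ _ => Iff.rfl

/-- The undirected graph joining each vertex to its parent. -/
def parentGraph (f : V → V) : SimpleGraph V :=
  .fromRel fun u v => f u = v

lemma reachable_parentGraph_iterate (f : V → V) (k : ℕ) (u : V) :
    (parentGraph f).Reachable u (f^[k] u) := by
  induction k generalizing u with
  | zero => rfl
  | succ k ih =>
    by_cases h : u = f u
    · rw [iterate_fixed h.symm]
    · exact (show (parentGraph f).Adj u (f u) from ⟨h, .inl rfl⟩).reachable.trans (ih (f u))

lemma IsForestMap.connected_parentGraph (hf : IsForestMap f {r}) : (parentGraph f).Connected := by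
  refine (SimpleGraph.connected_iff_exists_forall_reachable _).2 ⟨r, fun u => ?_⟩
  obtain ⟨k, rfl⟩ := hf.exists_iterate_mem u
  exact (reachable_parentGraph_iterate f k u).symm

lemma IsForestMap.edgeSet_parentGraph_subset (hf : IsForestMap f {r}) :
    (parentGraph f).edgeSet ⊆ (fun v => s(v, f v)) '' {r}ᶜ := by
  have hroot {u : V} (hu : u ≠ f u) : u ∈ ({r}ᶜ : Set V) := fun hur => hu (hf.apply_root u hur).symm
  intro e he
  induction e using Sym2.ind with
  | _ a b =>
    obtain ⟨hne : a ≠ b, rfl | rfl⟩ := (parentGraph f).mem_edgeSet.1 he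
    · exact ⟨a, hroot hne, rfl⟩
    · exact ⟨b, hroot hne.symm, Sym2.eq_swap⟩

lemma IsForestMap.isTree_parentGraph [Finite V] (hf : IsForestMap f {r}) :
    (parentGraph f).IsTree := by
  have hconn := hf.connected_parentGraph
  refine SimpleGraph.isTree_iff_connected_and_card.2
    ⟨hconn, le_antisymm ?_ hconn.card_vert_le_card_edgeSet_add_one⟩
  calc
    Nat.card (parentGraph f).edgeSet + 1
    _ ≤ ({r}ᶜ : Set V).ncard + 1 := by
      gcongr
      exact (Set.ncard_le_ncard hf.edgeSet_parentGraph_subset).trans Set.ncard_image_le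
    _ = Nat.card V := by
      rw [add_comm, ← Set.ncard_singleton r, Set.ncard_add_ncard_compl]

lemma exists_adj_dist_eq_add_one {G : SimpleGraph V} (hG : G.Connected) (hv : v ≠ r) :
    ∃ u, G.Adj v u ∧ G.dist r v = G.dist r u + 1 := by
  obtain ⟨p, hp⟩ := hG.exists_walk_length_eq_dist v r
  cases p with
  | nil => exact absurd rfl hv
  | @cons _ u _ h q =>
    refine ⟨u, h, ?_⟩
    have h1 := G.dist_le q
    have h2 : G.dist v r ≤ G.dist v u + G.dist u r := hG.dist_triangle
    rw [SimpleGraph.dist_eq_one_iff_adj.2 h] at h2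
    rw [SimpleGraph.Walk.length_cons] at hp
    rw [G.dist_comm (u := r), G.dist_comm (u := r)]
    omega

lemma IsForestMap.dist_parentGraph (hf : IsForestMap f {r}) (hv : v ≠ r) :
    (parentGraph f).dist r v = (parentGraph f).dist r (f v) + 1 := by
  induction hd : (parentGraph f).dist r v using Nat.strong_induction_on generalizing v with
  | _ d ih =>
    obtain ⟨u, ⟨hne, rfl | rfl⟩, hu⟩ := exists_adj_dist_eq_add_one hf.connected_parentGraph hv
    · rw [← hd, hu]
    · have hur : u ≠ r := fun h => hne (by rw [h, hf.apply_root r rfl])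
      have := ih _ (by omega) hur rfl
      omega

lemma IsForestMap.childDigraph_eq (hf : IsForestMap f {r}) :
    childDigraph f = reverse (orientTowards (parentGraph f) r) := by
  have hroot {u : V} (hu : u ≠ f u) : u ≠ r := fun hur => hu (hf.apply_root u hur).symm
  ext u v
  constructor
  · rintro ⟨rfl, hne⟩
    exact ⟨⟨hne.symm, .inl rfl⟩, hf.dist_parentGraph (hroot hne.symm)⟩
  · rintro ⟨⟨hne, rfl | rfl⟩, hd⟩
    · exact ⟨rfl, hne.symm⟩
    · have := hf.dist_parentGraph (hroot hne.symm)
      omega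

lemma exists_isForestMap_parentGraph_eq {G : SimpleGraph V} (hG : G.IsTree) (r : V) :
    ∃ f, IsForestMap f {r} ∧ parentGraph f = G := by
  have hparent (v : V) : ∃ u, (v = r → u = r) ∧
      (v ≠ r → G.Adj v u ∧ G.dist r v = G.dist r u + 1) := by
    rcases eq_or_ne v r with rfl | hv
    · exact ⟨v, by simp⟩
    · simpa [hv] using exists_adj_dist_eq_add_one hG.connected hv
  choose f hroot hadj using hparent
  have hf : IsForestMap f {r} := by
    refine ⟨fun v hv => (hroot v hv).trans hv.symm, fun u => ?_⟩
    induction hd : G.dist r u generalizing u with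
    | zero => exact ⟨0, (hG.connected.dist_eq_zero_iff.1 hd).symm⟩
    | succ d ih =>
      have hu : u ≠ r := by
        rintro rfl
        simp at hd
      obtain ⟨k, hk⟩ := ih (f u) (by have := (hadj u hu).2; omega)
      exact ⟨k + 1, hk⟩
  have hle : parentGraph f ≤ G := by
    have hedge {u : V} (hu : u ≠ f u) : G.Adj u (f u) :=
      (hadj u fun hur => hu ((hroot u hur).trans hur.symm).symm).1
    rintro u v ⟨hne, rfl | rfl⟩
    exacts [hedge hne, (hedge hne.symm).symm]
  exact ⟨f, hf, (SimpleGraph.isTree_iff_minimal_connected.1 hG).eq_of_le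
    hf.connected_parentGraph hle⟩

lemma sourceTrees_eq_image (n : ℕ) : sourceTrees n = childDigraph '' {f | IsTreeMap f} := by
  ext D
  constructor
  · rintro ⟨_, ⟨G, r, hG, rfl⟩, rfl⟩
    obtain ⟨f, hf, rfl⟩ := exists_isForestMap_parentGraph_eq hG r
    exact ⟨f, ⟨r, hf⟩, hf.childDigraph_eq⟩
  · rintro ⟨f, ⟨r, hf⟩, rfl⟩
    exact ⟨_, ⟨parentGraph f, r, hf.isTree_parentGraph, rfl⟩, hf.childDigraph_eq.symm⟩

lemma inverseMappingDigraphs_eq_range (n : ℕ) :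
    inverseMappingDigraphs n = Set.range fun f => reverse (mappingDigraph f) :=
  (Set.range_comp reverse mappingDigraph).symm

open Classical in
lemma numParking_eq_card [Fintype V] (hD : HasParentMap D f) (m : ℕ) :
    numParking D m = Finset.card {s : Fin m → V | DescendantSumsNonpos f (excess s)} := by
  simp only [numParking, isParkingFunction_iff_descendantSumsNonpos hD.reflTransGen_iff,
    Set.ncard_eq_toFinset_card', Set.toFinset_ofPred]

lemma sum_numParking_image [Fintype V] {d : (V → V) → Digraph V} (hd : ∀ f, HasParentMap (d f) f)
    (T : Set (V → V)) (hT : (d '' T).Finite) (m : ℕ) :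
    ∑ D ∈ hT.toFinset, numParking D m =
      ∑ s : Fin m → V, Nat.card {f // f ∈ T ∧ DescendantSumsNonpos f (excess s)} := by
  classical
  have hinj : Injective d := fun f g hfg => (hd f).unique (hfg ▸ hd g)
  have himage : hT.toFinset = Finset.image d {f | f ∈ T} := by
    ext D
    simp
  simp only [himage, Finset.sum_image hinj.injOn, numParking_eq_card (hd _),
    Nat.card_eq_fintype_card, Fintype.card_subtype, ← Finset.filter_filter]
  exact Finset.sum_card_bipartiteAbove_eq_sum_card_bipartiteBelow
    fun f s => DescendantSumsNonpos f (excess s)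

lemma sourceTreeTotal_eq_sum (n m : ℕ) : sourceTreeTotal n m =
    ∑ s : Fin m → Fin n, Nat.card {f // IsTreeMap f ∧ DescendantSumsNonpos f (excess s)} := by
  simp only [sourceTreeTotal, sourceTrees_eq_image]
  exact sum_numParking_image hasParentMap_childDigraph _ _ m

lemma inverseMappingTotal_eq_sum (n m : ℕ) : inverseMappingTotal n m =
    ∑ s : Fin m → Fin n, Nat.card {f // DescendantSumsNonpos f (excess s)} := by
  simp only [inverseMappingTotal, inverseMappingDigraphs_eq_range, ← Set.image_univ]
  simpa using sum_numParking_image hasParentMap_reverse_mappingDigraph Set.univ (Set.toFinite _) m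

end ParentDigraph

end DigraphParking

theorem mainTheorem2_general (n m : ℕ) (hn : 1 ≤ n) :
    n * DigraphParking.sourceTreeTotal n m = DigraphParking.inverseMappingTotal n m := by
  have : NeZero n := ⟨by omega⟩
  rw [DigraphParking.sourceTreeTotal_eq_sum, DigraphParking.inverseMappingTotal_eq_sum,
    Finset.mul_sum]
  refine Finset.sum_congr rfl fun s _ => ?_
  simpa using DigraphParking.card_mul_natCard_isTreeMap (DigraphParking.excess s)

theorem mainTheorem2 (n : ℕ) (hn : 1 ≤ n) :
    n * DigraphParking.sourceTreeTotal n n = DigraphParking.inverseMappingTotal n n :=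
  mainTheorem2_general n n hn
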